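/- **Setting.** Let $K$ be an extremally disconnected compact Hausdorff space. $C^\infty(K)$ is the vector lattice of continuous functions $K\to[-\infty,\infty]$ that are finite except on a nowhere dense set; sums and scalar multiples are taken pointwise where the functions are finite and extended by continuity, and the order is pointwise. Let $E$ be an order complete real vector lattice with a weak unit $e$, and fix a Maeda–Ogasawara representation of $E$, i.e. an injective linear lattice homomorphism of $E$ onto an order dense ideal of $C^\infty(K)$ that takes $e$ to the constant function $1$. We identify $E$ with its image; $E^u=C^\infty(K)$ is the universal completion of $E$, and $E^s=\{u\in C(K,[-\infty,\infty]) : u\ge x \text{ for some } x\in E\}$, ordered pointwise, is its sup-completion. **The functional calculus.** Let $X\in E$. For $t\in\mathbb R$ put $A_t=e-P_{(X-te)^+}e$, where $P_Y$ is the band projection onto the band generated by $Y$, and let $A_\infty=\sup_t A_t$, $A_{-\infty}=\inf_t A_t$. For $-\infty\le a<b\le\infty$ let $\mu_A(\{t\in\mathbb R: a<t\le b\})=A_b-A_a$, and extend $\mu_A$ additively to the algebra $F(\mathbb R)$ of finite disjoint unions of such sets. * $\mathbb L$ is the space of functions $f=\sum_{i=1}^n c_i\mathbf 1_{S_i}$,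 where $c_i\in\mathbb R$ and $(S_i)$ is a finite partition of $\mathbb R$ into members of $F(\mathbb R)$; for such $f$, $I(f)=\sum_i c_i\mu_A(S_i)\in E$. * $\mathbb L^\uparrow$ is the set of $f:\mathbb R\to[-\infty,\infty]$ for which there are $f_n\in\mathbb L$ with $f_n(t)\uparrow f(t)$ for every $t$; for such $f$, $I(f)=\sup_n I(f_n)$, the supremum being taken in $E^s$. * $\mathbb L^\uparrow_0$ is the set of real valued positive functions in $\mathbb L^\uparrow$, and $\mathbb L_u$ is the set of all $f=g-h$ with $g,h\in\mathbb L^\uparrow_0$ and $I(g),I(h)\in E^u$; for such $f$, $I(f)=I(g)-I(h)\in E^u$. For a continuous $f:\mathbb R\to\mathbb R$, let $f\circ X\in C^\infty(K)$ be the unique continuous extension to $K$ of $\omega\mapsto f(X(\omega))$, which is defined and continuous on the open dense set where $X$ is finite. **Theorem.** For every continuous $f:\mathbb R\to\mathbb R$ and every $X\in E$, $f$ belongs to $\mathbb L_u$ and $I(f)=f\circ X$; that is, such decompositions and approximating sequences for $f$ exist, and every choice of them yields the value $f\circ X$. In particular $I(f)\in E^u$. -/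

import Mathlib

open Set Filter Topology

/-! ### The vector lattice `C^∞(K)` -/

/-- `C^∞(K)`: the continuous functions `K → [-∞, ∞]` that are finite except on a nowhere dense
set. (By continuity, two such functions that agree off a nowhere dense set are equal.) -/
def CInfty (K : Type*) [TopologicalSpace K] : Type _ :=
  {u : C(K, EReal) // IsNowhereDense {ω | u ω = ⊥ ∨ u ω = ⊤}}

namespace CInfty

variable {K : Type*} [TopologicalSpace K]

noncomputable instance : CoeFun (CInfty K) (fun _ => K → EReal) := ⟨fun u => u.1⟩

/-- The set of points where `u` is finite. -/
def finiteSet (u : CInfty K) : Set K := {ω | u ω ≠ ⊥ ∧ u ω ≠ ⊤}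

theorem continuous (u : CInfty K) : Continuous u := u.1.continuous

theorem isOpen_finiteSet (u : CInfty K) : IsOpen u.finiteSet :=
  (isOpen_ne.preimage u.continuous).inter (isOpen_ne.preimage u.continuous)

theorem dense_finiteSet (u : CInfty K) : Dense u.finiteSet := by
  have h : u.finiteSet = {ω | u ω = ⊥ ∨ u ω = ⊤}ᶜ := by
    ext ω; simp [finiteSet]
  rw [h, ← interior_eq_empty_iff_dense_compl]
  exact Set.subset_empty_iff.1 ((interior_mono subset_closure).trans u.2.le)

theorem isNowhereDense_of_dense {u : C(K, EReal)} {U : Set K} (hU : Dense U)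
    (h : ∀ ω ∈ U, u ω ≠ ⊥ ∧ u ω ≠ ⊤) : IsNowhereDense {ω | u ω = ⊥ ∨ u ω = ⊤} := by
  have hc : IsClosed {ω | u ω = ⊥ ∨ u ω = ⊤} :=
    (isClosed_singleton.preimage u.continuous).union (isClosed_singleton.preimage u.continuous)
  rw [hc.isNowhereDense_iff, interior_eq_empty_iff_dense_compl]
  refine hU.mono fun ω hω hn => ?_
  rcases hn with hn | hn
  · exact (h ω hω).1 hn
  · exact (h ω hω).2 hn

theorem ext_of_dense {u v : CInfty K} {U : Set K} (hU : Dense U) (h : ∀ ω ∈ U, u ω = v ω) :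
    u = v :=
  Subtype.ext (ContinuousMap.ext fun ω =>
    congrFun (Continuous.ext_on hU u.continuous v.continuous h) ω)

theorem coe_toReal {u : CInfty K} {ω : K} (h : ω ∈ u.finiteSet) :
    (((u ω).toReal : ℝ) : EReal) = u ω := EReal.coe_toReal h.2 h.1

theorem mem_finiteSet_of_eq {u : CInfty K} {ω : K} {r : ℝ} (h : u ω = (r : EReal)) :
    ω ∈ u.finiteSet := ⟨by rw [h]; exact EReal.coe_ne_bot r, by rw [h]; exact EReal.coe_ne_top r⟩

theorem continuousOn_toReal (u : CInfty K) :
    ContinuousOn (fun ω => (u ω).toReal) u.finiteSet :=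
  EReal.continuousOn_toReal.comp u.continuous.continuousOn fun ω hω => by
    simpa [finiteSet] using hω

/-- The order and the lattice operations are the pointwise ones. -/
noncomputable instance : PartialOrder (CInfty K) := Subtype.partialOrder _

theorem le_def {u v : CInfty K} : u ≤ v ↔ ∀ ω, u ω ≤ v ω := Iff.rfl

theorem dense_inter (u v : CInfty K) : Dense (u.finiteSet ∩ v.finiteSet) :=
  u.dense_finiteSet.inter_of_isOpen_left v.dense_finiteSet u.isOpen_finiteSet

noncomputable instance : Lattice (CInfty K) where
  sup u v := ⟨u.1 ⊔ v.1, isNowhereDense_of_dense (dense_inter u v) fun ω hω => by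
    change max (u ω) (v ω) ≠ ⊥ ∧ max (u ω) (v ω) ≠ ⊤
    rcases max_choice (u ω) (v ω) with h | h
    · rw [h]; exact hω.1
    · rw [h]; exact hω.2⟩
  inf u v := ⟨u.1 ⊓ v.1, isNowhereDense_of_dense (dense_inter u v) fun ω hω => by
    change min (u ω) (v ω) ≠ ⊥ ∧ min (u ω) (v ω) ≠ ⊤
    rcases min_choice (u ω) (v ω) with h | h
    · rw [h]; exact hω.1
    · rw [h]; exact hω.2⟩
  le_sup_left u v := fun ω => le_max_left (u ω) (v ω)
  le_sup_right u v := fun ω => le_max_right (u ω) (v ω)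
  sup_le u v w h₁ h₂ := fun ω => max_le (h₁ ω) (h₂ ω)
  inf_le_left u v := fun ω => min_le_left (u ω) (v ω)
  inf_le_right u v := fun ω => min_le_right (u ω) (v ω)
  le_inf u v w h₁ h₂ := fun ω => le_min (h₁ ω) (h₂ ω)

/-- Real constants as elements of `C^∞(K)`. -/
noncomputable def const (r : ℝ) : CInfty K :=
  ⟨ContinuousMap.const K (r : EReal), isNowhereDense_of_dense dense_univ fun _ _ =>
    ⟨EReal.coe_ne_bot r, EReal.coe_ne_top r⟩⟩

noncomputable instance : Zero (CInfty K) := ⟨const 0⟩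

noncomputable instance : One (CInfty K) := ⟨const 1⟩

theorem zero_apply (ω : K) : (0 : CInfty K) ω = ((0 : ℝ) : EReal) := rfl

theorem zero_fin (ω : K) : ω ∈ (0 : CInfty K).finiteSet := mem_finiteSet_of_eq (zero_apply ω)

variable [ExtremallyDisconnected K]

/-- On an extremally disconnected space, a continuous real function on a dense open set has limits
in `[-∞, ∞]` at all points. -/
theorem exists_tendsto {U : Set K} (hUo : IsOpen U) (hU : Dense U) {g : K → ℝ}
    (hg : ContinuousOn g U) (ω : K) :
    ∃ y : EReal, Tendsto (fun x => (g x : EReal)) (𝓝[U] ω) (𝓝 y) := by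
  have hne : (𝓝[U] ω).NeBot := mem_closure_iff_nhdsWithin_neBot.1 (hU ω)
  set F : K → EReal := fun x => (g x : EReal)
  have key : ∀ a b : EReal, MapClusterPt a (𝓝[U] ω) F → MapClusterPt b (𝓝[U] ω) F →
      ¬ a < b := by
    intro a b ha hb hab
    obtain ⟨c, hac, hcb⟩ := exists_between hab
    have hF : ContinuousOn F U := continuous_coe_real_ereal.comp_continuousOn hg
    have h1 : IsOpen (U ∩ F ⁻¹' Iio c) := hF.isOpen_inter_preimage hUo isOpen_Iio
    have h2 : IsOpen (U ∩ F ⁻¹' Ioi c) := hF.isOpen_inter_preimage hUo isOpen_Ioi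
    have hd : Disjoint (U ∩ F ⁻¹' Iio c) (U ∩ F ⁻¹' Ioi c) :=
      Set.disjoint_left.2 fun x hx hy => lt_asymm (show F x < c from hx.2) (show c < F x from hy.2)
    have hcl : ∀ {y : EReal} {V : Set EReal}, MapClusterPt y (𝓝[U] ω) F → V ∈ 𝓝 y →
        ω ∈ closure (U ∩ F ⁻¹' V) := by
      intro y V hy hV
      rw [mem_closure_iff_nhds]
      intro t ht
      have hf : ∃ᶠ x in 𝓝[U] ω, F x ∈ V := hy.frequently hV
      have he : ∀ᶠ x in 𝓝[U] ω, x ∈ U ∩ t :=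
        inter_mem self_mem_nhdsWithin (mem_nhdsWithin_of_mem_nhds ht)
      obtain ⟨x, hx1, hx2⟩ := (hf.and_eventually he).exists
      exact ⟨x, hx2.2, hx2.1, hx1⟩
    exact Set.disjoint_left.1
      (ExtremallyDisconnected.disjoint_closure_of_disjoint_isOpen hd h1 h2)
      (hcl ha (Iio_mem_nhds hac)) (hcl hb (Ioi_mem_nhds hcb))
  obtain ⟨y, hy⟩ : ∃ y, ClusterPt y (map F (𝓝[U] ω)) := exists_clusterPt_of_compactSpace _
  refine ⟨y, le_nhds_of_unique_clusterPt fun z hz => ?_⟩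
  exact le_antisymm (not_lt.1 (key y z hy hz)) (not_lt.1 (key z y hz hy))

/-- The unique continuous extension to `K` of a continuous real function on a dense open set. -/
noncomputable def extend (U : Set K) (hUo : IsOpen U) (hU : Dense U) (g : K → ℝ)
    (hg : ContinuousOn g U) : CInfty K :=
  ⟨⟨extendFrom U fun ω => (g ω : EReal),
      continuous_extendFrom hU fun ω => exists_tendsto hUo hU hg ω⟩,
    isNowhereDense_of_dense hU fun ω hω => by
      have h : extendFrom U (fun ω => (g ω : EReal)) ω = (g ω : EReal) :=
        extendFrom_eq (hU ω) (continuous_coe_real_ereal.comp_continuousOn hg ω hω)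
      change extendFrom U (fun ω => (g ω : EReal)) ω ≠ ⊥ ∧
        extendFrom U (fun ω => (g ω : EReal)) ω ≠ ⊤
      rw [h]
      exact ⟨EReal.coe_ne_bot _, EReal.coe_ne_top _⟩⟩

theorem extend_apply {U : Set K} {hUo : IsOpen U} {hU : Dense U} {g : K → ℝ}
    {hg : ContinuousOn g U} {ω : K} (hω : ω ∈ U) :
    extend U hUo hU g hg ω = (g ω : EReal) :=
  extendFrom_eq (hU ω) (continuous_coe_real_ereal.comp_continuousOn hg ω hω)

/-- The sum: pointwise where both functions are finite, extended by continuity. -/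
noncomputable instance : Add (CInfty K) where
  add u v := extend (u.finiteSet ∩ v.finiteSet) (u.isOpen_finiteSet.inter v.isOpen_finiteSet)
    (dense_inter u v) (fun ω => (u ω).toReal + (v ω).toReal)
    ((u.continuousOn_toReal.mono inter_subset_left).add
      (v.continuousOn_toReal.mono inter_subset_right))

/-- Scalar multiplication: pointwise where the function is finite, extended by continuity. -/
noncomputable instance : SMul ℝ (CInfty K) where
  smul c u := extend u.finiteSet u.isOpen_finiteSet u.dense_finiteSet
    (fun ω => c * (u ω).toReal) (continuousOn_const.mul u.continuousOn_toReal)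

noncomputable instance : Neg (CInfty K) := ⟨fun u => (-1 : ℝ) • u⟩

/-- The composition `f ∘ X`: pointwise where `X` is finite, extended by continuity. -/
noncomputable def comp (f : ℝ → ℝ) (hf : Continuous f) (X : CInfty K) : CInfty K :=
  extend X.finiteSet X.isOpen_finiteSet X.dense_finiteSet (fun ω => f (X ω).toReal)
    (hf.comp_continuousOn X.continuousOn_toReal)

theorem add_apply {u v : CInfty K} {ω : K} (hu : ω ∈ u.finiteSet) (hv : ω ∈ v.finiteSet) :
    (u + v) ω = (((u ω).toReal + (v ω).toReal : ℝ) : EReal) :=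
  extend_apply (ω := ω) ⟨hu, hv⟩

theorem smul_apply (c : ℝ) {u : CInfty K} {ω : K} (hu : ω ∈ u.finiteSet) :
    (c • u) ω = ((c * (u ω).toReal : ℝ) : EReal) :=
  extend_apply (ω := ω) hu

theorem neg_apply {u : CInfty K} {ω : K} (hu : ω ∈ u.finiteSet) :
    (-u) ω = (((-1) * (u ω).toReal : ℝ) : EReal) :=
  smul_apply (-1) hu

theorem add_fin {u v : CInfty K} {ω : K} (hu : ω ∈ u.finiteSet) (hv : ω ∈ v.finiteSet) :
    ω ∈ (u + v).finiteSet := mem_finiteSet_of_eq (add_apply hu hv)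

theorem smul_fin (c : ℝ) {u : CInfty K} {ω : K} (hu : ω ∈ u.finiteSet) :
    ω ∈ (c • u).finiteSet := mem_finiteSet_of_eq (smul_apply c hu)

theorem neg_fin {u : CInfty K} {ω : K} (hu : ω ∈ u.finiteSet) :
    ω ∈ (-u).finiteSet := mem_finiteSet_of_eq (neg_apply hu)

noncomputable instance : AddCommGroup (CInfty K) where
  add_assoc u v w := ext_of_dense
    ((dense_inter u v).inter_of_isOpen_left w.dense_finiteSet
      (u.isOpen_finiteSet.inter v.isOpen_finiteSet)) fun ω ⟨⟨hu, hv⟩, hw⟩ => by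
    rw [add_apply (add_fin hu hv) hw, add_apply hu (add_fin hv hw), add_apply hu hv,
      add_apply hv hw, EReal.toReal_coe, EReal.toReal_coe, add_assoc]
  zero_add u := ext_of_dense u.dense_finiteSet fun ω hu => by
    rw [add_apply (zero_fin ω) hu, zero_apply, EReal.toReal_coe, zero_add, coe_toReal hu]
  add_zero u := ext_of_dense u.dense_finiteSet fun ω hu => by
    rw [add_apply hu (zero_fin ω), zero_apply, EReal.toReal_coe, add_zero, coe_toReal hu]
  nsmul := nsmulRec
  zsmul := zsmulRec
  neg_add_cancel u := ext_of_dense u.dense_finiteSet fun ω hu => by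
    rw [add_apply (neg_fin hu) hu, neg_apply hu, EReal.toReal_coe, zero_apply, neg_one_mul,
      neg_add_cancel]
  add_comm u v := ext_of_dense (dense_inter u v) fun ω ⟨hu, hv⟩ => by
    rw [add_apply hu hv, add_apply hv hu, add_comm]

noncomputable instance : Module ℝ (CInfty K) where
  one_smul u := ext_of_dense u.dense_finiteSet fun ω hu => by
    rw [smul_apply 1 hu, one_mul, coe_toReal hu]
  mul_smul a b u := ext_of_dense u.dense_finiteSet fun ω hu => by
    rw [smul_apply _ hu, smul_apply a (smul_fin b hu), smul_apply b hu, EReal.toReal_coe,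
      mul_assoc]
  smul_zero a := ext_of_dense dense_univ fun ω _ => by
    rw [smul_apply a (zero_fin ω), zero_apply, EReal.toReal_coe, mul_zero]
  smul_add a u v := ext_of_dense (dense_inter u v) fun ω ⟨hu, hv⟩ => by
    rw [smul_apply a (add_fin hu hv), add_apply hu hv, add_apply (smul_fin a hu) (smul_fin a hv),
      smul_apply a hu, smul_apply a hv, EReal.toReal_coe, EReal.toReal_coe, EReal.toReal_coe,
      mul_add]
  add_smul a b u := ext_of_dense u.dense_finiteSet fun ω hu => by
    rw [smul_apply _ hu, add_apply (smul_fin a hu) (smul_fin b hu), smul_apply a hu,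
      smul_apply b hu, EReal.toReal_coe, EReal.toReal_coe, add_mul]
  zero_smul u := ext_of_dense u.dense_finiteSet fun ω hu => by
    rw [smul_apply 0 hu, zero_mul, zero_apply]

end CInfty

/-! ### Weak units, bands, representations -/

section VectorLattice

variable {E : Type*} [AddCommGroup E] [ConditionallyCompleteLattice E] [Module ℝ E]

/-- `e` is a weak (order) unit: `e ≥ 0` and only `0` is disjoint from `e`. -/
def IsWeakUnit (e : E) : Prop := 0 ≤ e ∧ ∀ x : E, |x| ⊓ e = 0 → x = 0

/-- A band: a solid linear subspace that is closed under existing suprema. -/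
structure IsBand (B : Submodule ℝ E) : Prop where
  solid : ∀ x y : E, |x| ≤ |y| → y ∈ B → x ∈ B
  isLUB_mem : ∀ (S : Set E) (s : E), S ⊆ B → IsLUB S s → s ∈ B

/-- The band generated by `Y`: the smallest band that contains `Y`. -/
def bandGenerated (Y : E) : Submodule ℝ E := sInf {B | IsBand B ∧ Y ∈ B}

/-- The band projection `P_Y` onto the band `B` generated by `Y`:
`P_Y x = sup (B ∩ [0, x])` for `x ≥ 0`, and `P_Y x = P_Y x⁺ - P_Y x⁻` in general. -/
noncomputable def bandProj (Y x : E) : E :=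
  sSup ((bandGenerated Y : Set E) ∩ Icc 0 (x ⊔ 0)) -
    sSup ((bandGenerated Y : Set E) ∩ Icc 0 (-x ⊔ 0))

variable {K : Type*} [TopologicalSpace K] [ExtremallyDisconnected K]

/-- `Φ` is a Maeda-Ogasawara representation of `E` in `C^∞(K)` that takes `e` to the constant
function `1`: an injective linear lattice homomorphism whose range is an order dense ideal. -/
structure IsMaedaOgasawara (e : E) (Φ : E →ₗ[ℝ] CInfty K) : Prop where
  injective : Function.Injective Φ
  map_sup : ∀ x y : E, Φ (x ⊔ y) = Φ x ⊔ Φ y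
  map_inf : ∀ x y : E, Φ (x ⊓ y) = Φ x ⊓ Φ y
  ideal : ∀ (u : CInfty K) (x : E), |u| ≤ |Φ x| → u ∈ range Φ
  order_dense : ∀ u : CInfty K, 0 < u → ∃ x : E, 0 < Φ x ∧ Φ x ≤ u
  map_unit : Φ e = 1

/-- The sup-completion `E^s`: the continuous functions `K → [-∞, ∞]` that dominate an element
of `E`, ordered pointwise. -/
def SupCompletion (Φ : E →ₗ[ℝ] CInfty K) : Type _ :=
  {u : C(K, EReal) // ∃ x : E, (Φ x).1 ≤ u}

noncomputable instance (Φ : E →ₗ[ℝ] CInfty K) : PartialOrder (SupCompletion Φ) := Subtype.partialOrder _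

/-- The embedding of `E` in `E^s`. -/
noncomputable def SupCompletion.of (Φ : E →ₗ[ℝ] CInfty K) (x : E) : SupCompletion Φ :=
  ⟨(Φ x).1, x, le_rfl⟩

/-! ### The Daniell functional calculus

The functional `I = I_X` is introduced through its graph, first on step functions, then on their
increasing limits, then on differences of such limits. -/

/-- The right continuous spectral system of `X`: `A_t = e - P_{(X - t e)⁺} e`. -/
noncomputable def spectralSystem (e X : E) (t : ℝ) : E := e - bandProj ((X - t • e) ⊔ 0) e

open Classical in
/-- The spectral system with `A_∞ = sup_t A_t` and `A_{-∞} = inf_t A_t` added. -/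
noncomputable def spectralSystemExt (e X : E) (s : EReal) : E :=
  if s = ⊤ then ⨆ t : ℝ, spectralSystem e X t
  else if s = ⊥ then ⨅ t : ℝ, spectralSystem e X t
  else spectralSystem e X s.toReal

/-- `(a, b]`, `(a, ∞)`, `(-∞, b]` and `ℝ`, as subsets of `ℝ` with end points in `[-∞, ∞]`. -/
def halfOpen (a b : EReal) : Set ℝ := {t | a < (t : EReal) ∧ (t : EReal) ≤ b}

/-- `S` belongs to the algebra `F(ℝ)` of finite disjoint unions of half open intervals, and
`m = μ_A(S)`, the sum of `A_b - A_a` over the intervals of such a union. -/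
def IsSpectralMeasure (e X : E) (S : Set ℝ) (m : E) : Prop :=
  ∃ (n : ℕ) (a b : Fin n → EReal),
    (∀ i, a i < b i) ∧
    (Pairwise fun i j => Disjoint (halfOpen (a i) (b i)) (halfOpen (a j) (b j))) ∧
    S = ⋃ i, halfOpen (a i) (b i) ∧
    m = ∑ i, (spectralSystemExt e X (b i) - spectralSystemExt e X (a i))

/-- `f ∈ 𝕃`, i.e. `f = ∑ cᵢ 1_{Sᵢ}` for a finite partition `(Sᵢ)` of `ℝ` into members of `F(ℝ)`,
and `y = I(f) = ∑ cᵢ μ_A(Sᵢ)`. -/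
def IsStepIntegral (e X : E) (f : ℝ → ℝ) (y : E) : Prop :=
  ∃ (n : ℕ) (c : Fin n → ℝ) (S : Fin n → Set ℝ) (m : Fin n → E),
    (∀ i, IsSpectralMeasure e X (S i) (m i)) ∧
    (Pairwise fun i j => Disjoint (S i) (S j)) ∧
    ⋃ i, S i = univ ∧
    (∀ t, f t = ∑ i, (S i).indicator (fun _ => c i) t) ∧
    y = ∑ i, c i • m i

/-- `f ∈ 𝕃^↑`, i.e. `f` is the pointwise limit of an increasing sequence `(f_n)` in `𝕃`, and
`u = I(f) = sup_n I(f_n)`, the supremum being taken in `E^s`. -/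
def IsUpperIntegral (Φ : E →ₗ[ℝ] CInfty K) (e X : E) (f : ℝ → EReal)
    (u : SupCompletion Φ) : Prop :=
  ∃ (g : ℕ → ℝ → ℝ) (y : ℕ → E),
    (∀ n, IsStepIntegral e X (g n) (y n)) ∧
    (∀ t, Monotone fun n => g n t) ∧
    (∀ t, IsLUB (range fun n => (g n t : EReal)) (f t)) ∧
    IsLUB (range fun n => SupCompletion.of Φ (y n)) u

/-- `g ∈ 𝕃^↑_0`, i.e. `g` is a real valued positive member of `𝕃^↑`, and `I(g)` is the element
`G` of `E^u = C^∞(K)`. -/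
def IsPosIntegral (Φ : E →ₗ[ℝ] CInfty K) (e X : E) (g : ℝ → ℝ) (G : CInfty K) : Prop :=
  (∀ t, 0 ≤ g t) ∧
    ∃ u : SupCompletion Φ, IsUpperIntegral Φ e X (fun t => (g t : EReal)) u ∧ u.1 = G.1

/-- The class `𝕃_u` of the differences `g - h` with `g, h ∈ 𝕃^↑_0` and `I(g), I(h) ∈ E^u`. -/
def classLu (Φ : E →ₗ[ℝ] CInfty K) (e X : E) : Set (ℝ → ℝ) :=
  {f | ∃ g h : ℝ → ℝ, (∃ G, IsPosIntegral Φ e X g G) ∧ (∃ H, IsPosIntegral Φ e X h H) ∧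
    f = g - h}

/-- The graph of the extension of `I` to `𝕃_u`: `f = g - h` and `z = I(g) - I(h)`, with
`g, h ∈ 𝕃^↑_0` and `I(g), I(h) ∈ E^u`. -/
def IsDaniellIntegral (Φ : E →ₗ[ℝ] CInfty K) (e X : E) (f : ℝ → ℝ) (z : CInfty K) : Prop :=
  ∃ (g h : ℝ → ℝ) (G H : CInfty K), IsPosIntegral Φ e X g G ∧ IsPosIntegral Φ e X h H ∧
    f = g - h ∧ z = G - H

end VectorLattice

/-!
Write `x` for the function representing `X`. Everything is computed off a meagre subset of `K`:
sums, scalar multiples and lattice operations of `C^∞(K)` are pointwise there, countably many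
meagre sets may be discarded at once, and by Baire's theorem two members of `C^∞(K)` that agree off
a meagre set are equal.

The element `A_s` is represented by the indicator function of `{x ≤ s}` (`aeEq_spectralSystemExt`).
This rests on the description of the band projection `P_Y e` as the indicator function of `{Y > 0}`
(`aeEq_bandProj`), where the meagre boundary of this open set may be ignored. Hence `I(f) = f ∘ x`
off a meagre set for every step function `f` (`IsStepIntegral.aeEq`). The supremum in `E^s` of a
sequence is its pointwise supremum off a meagre set, because `K` is extremally disconnected
(`eventually_isLUB`), so the formula `I(f) = f ∘ x` passes to increasing limits and to differences.
This shows that no choice of decompositions and approximating sequences can yield anything but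
`f ∘ X`.

For the existence of such choices, a continuous `f` is the difference of its positive and its
negative part. A continuous `f ≥ 0` is the increasing limit of the step functions that are equal to
the infimum of `f` on each cell of the partition of `ℝ` by the first `n` points of a dense sequence
(`isLUB_cellInf`), and the integrals of these have the supremum `f ∘ X` (`isPosIntegral_comp`).
-/

/-! ### Calculus in `C^∞(K)` off meagre sets -/

namespace CInfty

section Residual

variable {K : Type*} [TopologicalSpace K]

/-- `u` agrees with the real function `φ` off a meagre set. -/
def AEEq (u : CInfty K) (φ : K → ℝ) : Prop := ∀ᶠ ω in residual K, u ω = (φ ω : EReal)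

theorem eventually_mem_finiteSet (u : CInfty K) : ∀ᶠ ω in residual K, ω ∈ u.finiteSet :=
  residual_of_dense_open u.isOpen_finiteSet u.dense_finiteSet

theorem aeEq_toReal (u : CInfty K) : AEEq u fun ω => (u ω).toReal := by
  filter_upwards [u.eventually_mem_finiteSet] with ω hω
  exact (coe_toReal hω).symm

theorem AEEq.congr {u : CInfty K} {φ ψ : K → ℝ} (h : AEEq u φ)
    (hφ : ∀ᶠ ω in residual K, φ ω = ψ ω) : AEEq u ψ := by
  filter_upwards [h, hφ] with ω h₁ h₂
  rw [h₁, h₂]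

theorem le_of_eventually_le [BaireSpace K] {u v : C(K, EReal)}
    (h : ∀ᶠ ω in residual K, u ω ≤ v ω) : u ≤ v := by
  have hc : IsClosed {ω | u ω ≤ v ω} := isClosed_le u.continuous v.continuous
  have hd : Dense {ω | u ω ≤ v ω} := dense_of_mem_residual h
  intro ω
  have hω := hd ω
  rwa [hc.closure_eq] at hω

theorem AEEq.le [BaireSpace K] {u v : CInfty K} {φ ψ : K → ℝ} (hu : AEEq u φ) (hv : AEEq v ψ)
    (h : ∀ᶠ ω in residual K, φ ω ≤ ψ ω) : u ≤ v := by
  refine le_of_eventually_le (u := u.1) (v := v.1) ?_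
  filter_upwards [hu, hv, h] with ω h₁ h₂ h₃
  rw [h₁, h₂]
  exact_mod_cast h₃

theorem AEEq.eq [BaireSpace K] {u v : CInfty K} {φ : K → ℝ} (hu : AEEq u φ) (hv : AEEq v φ) :
    u = v :=
  le_antisymm (hu.le hv (.of_forall fun _ => le_rfl)) (hv.le hu (.of_forall fun _ => le_rfl))

theorem AEEq.eventually_le {u v : CInfty K} {φ ψ : K → ℝ} (hu : AEEq u φ) (hv : AEEq v ψ)
    (h : u ≤ v) : ∀ᶠ ω in residual K, φ ω ≤ ψ ω := by
  filter_upwards [hu, hv] with ω h₁ h₂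
  have h₃ : u ω ≤ v ω := h ω
  rw [h₁, h₂] at h₃
  exact_mod_cast h₃

theorem aeEq_zero : AEEq (0 : CInfty K) fun _ => 0 := .of_forall fun _ => rfl

theorem aeEq_one : AEEq (1 : CInfty K) fun _ => 1 := .of_forall fun _ => rfl

theorem AEEq.sup {u v : CInfty K} {φ ψ : K → ℝ} (hu : AEEq u φ) (hv : AEEq v ψ) :
    AEEq (u ⊔ v) fun ω => max (φ ω) (ψ ω) := by
  filter_upwards [hu, hv] with ω h₁ h₂
  change max (u ω) (v ω) = _
  rw [h₁, h₂]
  exact (EReal.coe_strictMono.monotone.map_max).symm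

theorem AEEq.inf {u v : CInfty K} {φ ψ : K → ℝ} (hu : AEEq u φ) (hv : AEEq v ψ) :
    AEEq (u ⊓ v) fun ω => min (φ ω) (ψ ω) := by
  filter_upwards [hu, hv] with ω h₁ h₂
  change min (u ω) (v ω) = _
  rw [h₁, h₂]
  exact (EReal.coe_strictMono.monotone.map_min).symm

open Classical in
/-- The function that equals `u` on the clopen set `C` and vanishes off `C`. -/
noncomputable def restrict (C : Set K) (hC : IsClopen C) (u : CInfty K) : CInfty K :=
  ⟨⟨C.piecewise u (fun _ => ((0 : ℝ) : EReal)),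
      u.continuous.piecewise (by simp [hC.frontier_eq]) continuous_const⟩,
    isNowhereDense_of_dense u.dense_finiteSet fun ω hω => by
      by_cases h : ω ∈ C
      · simpa [Set.piecewise, h, finiteSet] using hω
      · simp [Set.piecewise, h]⟩

open Classical in
theorem AEEq.restrict {C : Set K} (hC : IsClopen C) {u : CInfty K} {φ : K → ℝ} (hu : AEEq u φ) :
    AEEq (restrict C hC u) (C.indicator φ) := by
  filter_upwards [hu] with ω h
  change C.piecewise u (fun _ => ((0 : ℝ) : EReal)) ω = _
  by_cases hω : ω ∈ C <;> simp [hω, h]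

variable [ExtremallyDisconnected K]

theorem AEEq.add {u v : CInfty K} {φ ψ : K → ℝ} (hu : AEEq u φ) (hv : AEEq v ψ) :
    AEEq (u + v) fun ω => φ ω + ψ ω := by
  filter_upwards [hu, hv] with ω h₁ h₂
  rw [add_apply (mem_finiteSet_of_eq h₁) (mem_finiteSet_of_eq h₂), h₁, h₂, EReal.toReal_coe,
    EReal.toReal_coe]

theorem AEEq.smul {u : CInfty K} {φ : K → ℝ} (c : ℝ) (hu : AEEq u φ) :
    AEEq (c • u) fun ω => c * φ ω := by
  filter_upwards [hu] with ω h₁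
  rw [smul_apply c (mem_finiteSet_of_eq h₁), h₁, EReal.toReal_coe]

theorem AEEq.neg {u : CInfty K} {φ : K → ℝ} (hu : AEEq u φ) : AEEq (-u) fun ω => -φ ω := by
  filter_upwards [hu] with ω h₁
  rw [neg_apply (mem_finiteSet_of_eq h₁), h₁, EReal.toReal_coe, neg_one_mul]

theorem AEEq.sub {u v : CInfty K} {φ ψ : K → ℝ} (hu : AEEq u φ) (hv : AEEq v ψ) :
    AEEq (u - v) fun ω => φ ω - ψ ω := by
  simpa only [sub_eq_add_neg] using hu.add hv.neg

theorem AEEq.abs {u : CInfty K} {φ : K → ℝ} (hu : AEEq u φ) : AEEq |u| fun ω => |φ ω| :=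
  hu.sup hu.neg

theorem AEEq.sum {ι : Type*} (s : Finset ι) {u : ι → CInfty K} {φ : ι → K → ℝ}
    (h : ∀ i ∈ s, AEEq (u i) (φ i)) : AEEq (∑ i ∈ s, u i) fun ω => ∑ i ∈ s, φ i ω := by
  classical
  induction s using Finset.induction_on with
  | empty => simpa using aeEq_zero
  | insert a s ha ih =>
    simp only [Finset.sum_insert ha]
    exact (h a (s.mem_insert_self a)).add (ih fun i hi => h i (Finset.mem_insert_of_mem hi))

theorem aeEq_comp (f : ℝ → ℝ) (hf : Continuous f) (x : CInfty K) :
    AEEq (comp f hf x) fun ω => f (x ω).toReal := by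
  filter_upwards [x.eventually_mem_finiteSet] with ω hω
  exact extend_apply hω

end Residual

end CInfty

open CInfty

/-! ### The representation of the spectral system -/

section Representation

variable {E : Type*} [AddCommGroup E] [ConditionallyCompleteLattice E] [Module ℝ E]
  {K : Type*} [TopologicalSpace K] [ExtremallyDisconnected K] {e : E} {Φ : E →ₗ[ℝ] CInfty K}

theorem IsMaedaOgasawara.le_iff (hΦ : IsMaedaOgasawara e Φ) {x y : E} : Φ x ≤ Φ y ↔ x ≤ y := by
  rw [← sup_eq_right, ← hΦ.map_sup, hΦ.injective.eq_iff, sup_eq_right]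

theorem IsMaedaOgasawara.map_abs (hΦ : IsMaedaOgasawara e Φ) (x : E) : Φ |x| = |Φ x| := by
  change Φ (x ⊔ -x) = Φ x ⊔ -Φ x
  rw [hΦ.map_sup, map_neg]

/-- The range of `Φ` contains the restriction of each of its members to a clopen set. -/
theorem IsMaedaOgasawara.exists_restrict [BaireSpace K] (hΦ : IsMaedaOgasawara e Φ) {C : Set K}
    (hC : IsClopen C) (x : E) :
    ∃ x' : E, AEEq (Φ x') (C.indicator fun ω => (Φ x ω).toReal) := by
  have h := (aeEq_toReal (Φ x)).restrict hC
  obtain ⟨x', hx'⟩ := hΦ.ideal (CInfty.restrict C hC (Φ x)) x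
    (h.abs.le (aeEq_toReal (Φ x)).abs (.of_forall fun ω => by
      by_cases hω : ω ∈ C <;> simp [hω]))
  exact ⟨x', hx' ▸ h⟩

/-- The elements of `E` whose representing functions vanish off `C`, up to a meagre set. At points
where `Φ x` is infinite, `toReal` is `0`; these points form a meagre set. -/
def bandOn (Φ : E →ₗ[ℝ] CInfty K) (C : Set K) : Submodule ℝ E where
  carrier := {x | ∀ᶠ ω in residual K, ω ∉ C → (Φ x ω).toReal = 0}
  zero_mem' := by
    rw [Set.mem_ofPred_eq]
    refine Eventually.of_forall fun ω _ => ?_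
    rw [map_zero, CInfty.zero_apply, EReal.toReal_coe]
  add_mem' {x y} hx hy := by
    filter_upwards [hx, hy, (aeEq_toReal (Φ x)).add (aeEq_toReal (Φ y))] with ω h₁ h₂ h₃ hω
    rw [map_add, h₃, h₁ hω, h₂ hω, EReal.toReal_coe, add_zero]
  smul_mem' c x hx := by
    filter_upwards [hx, (aeEq_toReal (Φ x)).smul c] with ω h₁ h₂ hω
    rw [map_smul, h₂, h₁ hω, EReal.toReal_coe, mul_zero]

omit [ConditionallyCompleteLattice E] in
theorem mem_bandOn {C : Set K} {x : E} :
    x ∈ bandOn Φ C ↔ ∀ᶠ ω in residual K, ω ∉ C → (Φ x ω).toReal = 0 := Iff.rfl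

theorem isBand_bandOn [BaireSpace K] (hΦ : IsMaedaOgasawara e Φ) {C : Set K} (hC : IsClopen C) :
    IsBand (bandOn Φ C) where
  solid x y hxy hy := by
    have h := hΦ.le_iff.2 hxy
    rw [hΦ.map_abs, hΦ.map_abs] at h
    rw [mem_bandOn] at hy ⊢
    filter_upwards [(aeEq_toReal (Φ x)).abs.eventually_le (aeEq_toReal (Φ y)).abs h, hy]
      with ω h₁ h₂ hω
    rw [h₂ hω, abs_zero] at h₁
    exact abs_nonpos_iff.1 h₁
  isLUB_mem S s hS hs := by
    obtain ⟨s', hs'⟩ := hΦ.exists_restrict hC s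
    -- Cutting `s` off outside `C` does not affect its being an upper bound of `S`.
    have hub : s' ∈ upperBounds S := fun x hx => by
      refine hΦ.le_iff.1 ((aeEq_toReal (Φ x)).le hs' ?_)
      filter_upwards [hS hx, (aeEq_toReal (Φ x)).eventually_le (aeEq_toReal (Φ s))
        (hΦ.le_iff.2 (hs.1 hx))] with ω h₁ h₂
      by_cases hω : ω ∈ C
      · simpa [hω] using h₂
      · simpa [hω] using (h₁ hω).le
    have hle := (aeEq_toReal (Φ s)).eventually_le hs' (hΦ.le_iff.2 (hs.2 hub))
    obtain ⟨x, hxs, hx⟩ : ∃ x ≤ s, x ∈ bandOn Φ C := by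
      rcases S.eq_empty_or_nonempty with rfl | ⟨x, hx⟩
      · -- The supremum of the empty set is a least element of `E`, so `s ≤ 2s` and `s ≤ -s`.
        have hs0 : ∀ y, s ≤ y := fun y => hs.2 (by simp)
        refine ⟨s, le_rfl, mem_bandOn.2 ?_⟩
        filter_upwards [(aeEq_toReal (Φ s)).eventually_le
            ((aeEq_toReal (Φ s)).smul 2) (by rw [← map_smul]; exact hΦ.le_iff.2 (hs0 _)),
          (aeEq_toReal (Φ s)).eventually_le
            ((aeEq_toReal (Φ s)).smul (-1)) (by rw [← map_smul]; exact hΦ.le_iff.2 (hs0 _))]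
          with ω h₁ h₂ _
        linarith
      · exact ⟨x, hs.1 hx, hS hx⟩
    rw [mem_bandOn] at hx ⊢
    filter_upwards [hle, hx, (aeEq_toReal (Φ x)).eventually_le (aeEq_toReal (Φ s))
      (hΦ.le_iff.2 hxs)] with ω h₁ h₂ h₃ hω
    rw [h₂ hω] at h₃
    rw [Set.indicator_of_notMem hω] at h₁
    exact le_antisymm h₁ h₃

open Classical in
/-- The band projection of the unit onto the band generated by `Y ≥ 0` is represented by the
indicator function of `{Y > 0}`, up to a meagre set. -/
theorem aeEq_bandProj [BaireSpace K] [IsOrderedAddMonoid E] (he : IsWeakUnit e)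
    (hΦ : IsMaedaOgasawara e Φ) {Y : E} (hY : 0 ≤ Y) :
    AEEq (Φ (bandProj Y e)) fun ω => if 0 < (Φ Y ω).toReal then 1 else 0 := by
  have hYφ := aeEq_toReal (Φ Y)
  have h0 : AEEq (Φ (0 : E)) fun _ => 0 := by rw [map_zero]; exact aeEq_zero
  have h1 : AEEq (Φ e) fun _ => 1 := by rw [hΦ.map_unit]; exact aeEq_one
  have hYnn := h0.eventually_le hYφ (hΦ.le_iff.2 hY)
  set U : Set K := {ω | 0 < Φ Y ω} with hU
  have hUo : IsOpen U := isOpen_lt continuous_const (Φ Y).continuous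
  set C : Set K := closure U with hCdef
  have hC : IsClopen C := ⟨isClosed_closure, ExtremallyDisconnected.open_closure U hUo⟩
  -- Off the boundary of `U`, membership in the clopen set `C` means `Y > 0`.
  have hmem : ∀ᶠ ω in residual K, ω ∈ C ↔ 0 < (Φ Y ω).toReal := by
    have hfr : (frontier U)ᶜ ∈ residual K :=
      residual_of_dense_open isClosed_frontier.isOpen_compl
        (interior_eq_empty_iff_dense_compl.1 (by
          rw [← frontier_compl]
          exact interior_frontier hUo.isClosed_compl))
    filter_upwards [hfr, hYφ] with ω h₁ h₂
    have h₃ : ω ∈ C ↔ ω ∈ U := by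
      refine ⟨fun h => ?_, fun h => subset_closure h⟩
      by_contra hn
      exact h₁ ⟨h, by rwa [hUo.interior_eq]⟩
    rw [h₃, hU, mem_ofPred_eq, h₂, EReal.toReal_coe]
    exact EReal.coe_pos
  obtain ⟨q, hq⟩ := hΦ.exists_restrict hC e
  replace hq : AEEq (Φ q) fun ω => if 0 < (Φ Y ω).toReal then 1 else 0 := by
    refine hq.congr ?_
    filter_upwards [hmem, h1] with ω h₁ h₂
    by_cases h : ω ∈ C
    · rw [Set.indicator_of_mem h, if_pos (h₁.1 h), h₂, EReal.toReal_coe]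
    · rw [Set.indicator_of_notMem h, if_neg fun h' => h (h₁.2 h')]
  have hzero : (0 : E) ∈ (bandGenerated Y : Set E) := zero_mem _
  have hYC : Y ∈ bandOn Φ C := by
    rw [mem_bandOn]
    filter_upwards [hmem, hYnn] with ω h₁ h₂ hω
    exact le_antisymm (not_lt.1 fun h => hω (h₁.2 h)) h₂
  have hlub : IsLUB ((bandGenerated Y : Set E) ∩ Icc 0 (e ⊔ 0)) q := by
    rw [sup_eq_left.2 he.1]
    constructor
    · rintro z ⟨hzB, hz0, hze⟩
      have hz : z ∈ bandOn Φ C := Submodule.mem_sInf.1 hzB _ ⟨isBand_bandOn hΦ hC, hYC⟩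
      refine hΦ.le_iff.1 ((aeEq_toReal (Φ z)).le hq ?_)
      filter_upwards [hz, hmem, (aeEq_toReal (Φ z)).eventually_le h1 (hΦ.le_iff.2 hze)]
        with ω h₁ h₂ h₃
      split_ifs with h
      · exact h₃
      · exact (h₁ fun h' => h (h₂.1 h')).le
    · -- An upper bound dominates `nY ⊓ e` for all `n`, and `nY ⊓ e ↑ 1` on `{Y > 0}`.
      intro w hw
      have hn : ∀ n : ℕ, Φ ((n : ℝ) • Y ⊓ e) ≤ Φ w := fun n => by
        have hnY : 0 ≤ (n : ℝ) • Y := by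
          rw [Nat.cast_smul_eq_nsmul]
          exact nsmul_nonneg hY n
        have hnn : 0 ≤ (n : ℝ) • Y ⊓ e := le_inf hnY he.1
        refine hΦ.le_iff.2 (hw ⟨Submodule.mem_sInf.2 fun B hB => ?_, hnn, inf_le_right⟩)
        refine hB.1.solid _ ((n : ℝ) • Y) ?_ (B.smul_mem _ hB.2)
        rw [abs_of_nonneg hnn, abs_of_nonneg hnY]
        exact inf_le_left
      have hn' : ∀ n : ℕ, ∀ᶠ ω in residual K,
          min ((n : ℝ) * (Φ Y ω).toReal) 1 ≤ (Φ w ω).toReal := fun n => by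
        have h := (hYφ.smul n).inf h1
        rw [← map_smul, ← hΦ.map_inf] at h
        exact h.eventually_le (aeEq_toReal (Φ w)) (hn n)
      refine hΦ.le_iff.1 (hq.le (aeEq_toReal (Φ w)) ?_)
      filter_upwards [eventually_countable_forall.2 hn'] with ω h
      split_ifs with hω
      · obtain ⟨n, hn⟩ := exists_nat_ge (1 / (Φ Y ω).toReal)
        rw [div_le_iff₀ hω] at hn
        simpa [min_eq_right hn] using h n
      · simpa using h 0
  have hp : bandProj Y e = q := by
    have hneg : (bandGenerated Y : Set E) ∩ Icc 0 (-e ⊔ 0) = {0} := by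
      rw [sup_eq_right.2 (neg_nonpos.2 he.1), Icc_self]
      exact Set.inter_eq_right.2 (by simp)
    rw [bandProj, hneg, csSup_singleton, sub_zero]
    exact hlub.csSup_eq ⟨0, hzero, le_rfl, le_sup_right⟩
  rwa [hp]

open Classical in
theorem aeEq_spectralSystem [BaireSpace K] [IsOrderedAddMonoid E] (he : IsWeakUnit e)
    (hΦ : IsMaedaOgasawara e Φ) (X : E) (t : ℝ) :
    AEEq (Φ (spectralSystem e X t)) fun ω => if (Φ X ω).toReal ≤ t then 1 else 0 := by
  have h1 : AEEq (Φ e) fun _ => 1 := by rw [hΦ.map_unit]; exact aeEq_one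
  have hY : AEEq (Φ ((X - t • e) ⊔ 0)) fun ω => max ((Φ X ω).toReal - t * 1) 0 := by
    rw [hΦ.map_sup, map_sub, map_smul, map_zero]
    exact ((aeEq_toReal _).sub (h1.smul t)).sup aeEq_zero
  have h := h1.sub (aeEq_bandProj he hΦ (Y := (X - t • e) ⊔ 0) le_sup_right)
  rw [← map_sub] at h
  refine h.congr ?_
  filter_upwards [hY] with ω hω
  rw [hω, EReal.toReal_coe, mul_one]
  by_cases hle : (Φ X ω).toReal ≤ t
  · rw [if_pos hle, if_neg (by simpa using hle), sub_zero]
  · rw [if_neg hle, if_pos (by simpa using hle), sub_self]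

open Classical in
/-- `A_s` is represented by the indicator function of `{X ≤ s}`, up to a meagre set. Since `X` is
finite off a meagre set, this gives `A_∞ = e` and `A_{-∞} = 0`. -/
theorem aeEq_spectralSystemExt [BaireSpace K] [IsOrderedAddMonoid E] (he : IsWeakUnit e)
    (hΦ : IsMaedaOgasawara e Φ) (X : E) (s : EReal) :
    AEEq (Φ (spectralSystemExt e X s))
      fun ω => if ((Φ X ω).toReal : EReal) ≤ s then 1 else 0 := by
  have h1 : AEEq (Φ e) fun _ => 1 := by rw [hΦ.map_unit]; exact aeEq_one
  have h0 : AEEq (Φ (0 : E)) fun _ => 0 := by rw [map_zero]; exact aeEq_zero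
  have hA := aeEq_spectralSystem he hΦ X
  induction s using EReal.rec with
  | bot =>
    have hglb : IsGLB (range fun t : ℝ => spectralSystem e X t) 0 := by
      constructor
      · rintro _ ⟨t, rfl⟩
        exact hΦ.le_iff.1 (h0.le (hA t) (.of_forall fun ω => by split_ifs <;> simp))
      · intro w hw
        refine hΦ.le_iff.1 ((aeEq_toReal (Φ w)).le h0 ?_)
        have h : ∀ n : ℕ, _ := fun n =>
          (aeEq_toReal (Φ w)).eventually_le (hA (-n)) (hΦ.le_iff.2 (hw ⟨_, rfl⟩))
        filter_upwards [eventually_countable_forall.2 h] with ω hω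
        obtain ⟨n, hn⟩ := exists_nat_gt (-(Φ X ω).toReal)
        have := hω n
        rwa [if_neg (by linarith)] at this
    have hE : spectralSystemExt e X ⊥ = 0 := by
      rw [spectralSystemExt, if_neg bot_ne_top, if_pos rfl]
      exact hglb.ciInf_eq
    rw [hE]
    exact h0.congr (.of_forall fun ω => by simp)
  | top =>
    have hlub : IsLUB (range fun t : ℝ => spectralSystem e X t) e := by
      constructor
      · rintro _ ⟨t, rfl⟩
        exact hΦ.le_iff.1 ((hA t).le h1 (.of_forall fun ω => by split_ifs <;> simp))
      · intro w hw
        refine hΦ.le_iff.1 (h1.le (aeEq_toReal (Φ w)) ?_)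
        have h : ∀ n : ℕ, _ := fun n =>
          (hA n).eventually_le (aeEq_toReal (Φ w)) (hΦ.le_iff.2 (hw ⟨_, rfl⟩))
        filter_upwards [eventually_countable_forall.2 h] with ω hω
        obtain ⟨n, hn⟩ := exists_nat_ge (Φ X ω).toReal
        have := hω n
        rwa [if_pos hn] at this
    have hE : spectralSystemExt e X ⊤ = e := by
      rw [spectralSystemExt, if_pos rfl]
      exact hlub.ciSup_eq
    rw [hE]
    exact h1.congr (.of_forall fun ω => by simp)
  | coe t =>
    rw [spectralSystemExt, if_neg (EReal.coe_ne_top t), if_neg (EReal.coe_ne_bot t),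
      EReal.toReal_coe]
    exact (hA t).congr (.of_forall fun ω => by simp)

/-! ### Integrals as compositions, up to a meagre set -/

theorem IsSpectralMeasure.aeEq [BaireSpace K] [IsOrderedAddMonoid E] (he : IsWeakUnit e)
    (hΦ : IsMaedaOgasawara e Φ) {X : E} {S : Set ℝ} {m : E} (h : IsSpectralMeasure e X S m) :
    AEEq (Φ m) fun ω => S.indicator (fun _ => 1) (Φ X ω).toReal := by
  classical
  obtain ⟨n, a, b, hab, hd, rfl, rfl⟩ := h
  have hA := aeEq_spectralSystemExt he hΦ X
  rw [map_sum]
  simp only [map_sub]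
  refine (AEEq.sum Finset.univ fun i _ => (hA (b i)).sub (hA (a i))).congr
    (.of_forall fun ω => ?_)
  generalize (Φ X ω).toReal = t
  have hU : (⋃ i, halfOpen (a i) (b i)) = ⋃ i ∈ Finset.univ, halfOpen (a i) (b i) := by simp
  rw [hU, Finset.indicator_biUnion _ _ fun i _ j _ hij => hd hij]
  refine Finset.sum_congr rfl fun i _ => ?_
  simp only [Set.indicator, halfOpen, mem_ofPred_eq]
  by_cases h₁ : (t : EReal) ≤ a i
  · simp [h₁, h₁.trans (hab i).le]
  · simp [h₁, lt_of_not_ge h₁]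

theorem IsStepIntegral.aeEq [BaireSpace K] [IsOrderedAddMonoid E] (he : IsWeakUnit e)
    (hΦ : IsMaedaOgasawara e Φ) {X : E} {f : ℝ → ℝ} {y : E} (h : IsStepIntegral e X f y) :
    AEEq (Φ y) fun ω => f (Φ X ω).toReal := by
  obtain ⟨n, c, S, m, hm, -, -, hf, rfl⟩ := h
  rw [map_sum]
  simp only [map_smul]
  refine (AEEq.sum Finset.univ fun i _ => ((hm i).aeEq he hΦ).smul (c i)).congr
    (.of_forall fun ω => ?_)
  rw [hf]
  refine Finset.sum_congr rfl fun i _ => ?_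
  by_cases h : (Φ X ω).toReal ∈ S i <;> simp [h]

omit [ConditionallyCompleteLattice E] in
/-- In `C(K, [-∞, ∞])`, a supremum of a sequence agrees with the pointwise supremum off a meagre
set. Otherwise, for some `p < q`, the sequence would be `≤ p` and its supremum `u` would be `≥ q`
on a nonempty open set; replacing `u` by `u ⊓ p` on the closure of this set, which is clopen,
would give a smaller upper bound. -/
theorem eventually_isLUB {v : ℕ → SupCompletion Φ} {u : SupCompletion Φ}
    (h : IsLUB (range v) u) :
    ∀ᶠ ω in residual K, IsLUB (range fun n => (v n).1 ω) (u.1 ω) := by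
  classical
  have key : ∀ pq : ℚ × ℚ, ∀ᶠ ω in residual K, pq.1 < pq.2 →
      (∀ n, (v n).1 ω ≤ ((pq.1 : ℝ) : EReal)) → ¬ ((pq.2 : ℝ) : EReal) ≤ u.1 ω := by
    rintro ⟨p, q⟩
    by_cases hpq : p < q
    swap
    · exact .of_forall fun ω h => absurd h hpq
    set F : Set K := {ω | (∀ n, (v n).1 ω ≤ ((p : ℝ) : EReal)) ∧ ((q : ℝ) : EReal) ≤ u.1 ω}
      with hF
    have hFc : IsClosed F := by
      have : F = (⋂ n, {ω | (v n).1 ω ≤ ((p : ℝ) : EReal)}) ∩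
          {ω | ((q : ℝ) : EReal) ≤ u.1 ω} := by
        ext ω; simp [hF]
      rw [this]
      exact (isClosed_iInter fun n => isClosed_le (v n).1.continuous continuous_const).inter
        (isClosed_le continuous_const u.1.continuous)
    have hint : interior F = ∅ := by
      by_contra hne
      obtain ⟨ω, hω⟩ := Set.nonempty_iff_ne_empty.2 hne
      set V : Set K := closure (interior F)
      have hV : IsClopen V :=
        ⟨isClosed_closure, ExtremallyDisconnected.open_closure _ isOpen_interior⟩
      have hVF : V ⊆ F := closure_minimal interior_subset hFc
      let u' : C(K, EReal) := ⟨V.piecewise (fun ω => min (u.1 ω) ((p : ℝ) : EReal)) u.1,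
        (u.1.continuous.min continuous_const).piecewise (by simp [hV.frontier_eq])
          u.1.continuous⟩
      have hvu' : ∀ n, (v n).1 ≤ u' := fun n ω => by
        have hle : (v n).1 ω ≤ u.1 ω := h.1 ⟨n, rfl⟩ ω
        change _ ≤ V.piecewise (fun ω => min (u.1 ω) ((p : ℝ) : EReal)) u.1 ω
        by_cases hω : ω ∈ V
        · rw [Set.piecewise_eq_of_mem _ _ _ hω]
          exact le_min hle ((hVF hω).1 n)
        · rwa [Set.piecewise_eq_of_notMem _ _ _ hω]
      obtain ⟨x, hx⟩ := (v 0).2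
      have hle : u ≤ (⟨u', x, hx.trans (hvu' 0)⟩ : SupCompletion Φ) := by
        refine h.2 ?_
        rintro _ ⟨n, rfl⟩
        exact hvu' n
      have hωV : ω ∈ V := subset_closure hω
      have h₁ : u.1 ω ≤ V.piecewise (fun ω => min (u.1 ω) ((p : ℝ) : EReal)) u.1 ω := hle ω
      rw [Set.piecewise_eq_of_mem _ _ _ hωV] at h₁
      have h₂ : ((q : ℝ) : EReal) ≤ ((p : ℝ) : EReal) :=
        (hVF hωV).2.trans (h₁.trans (min_le_right _ _))
      rw [EReal.coe_le_coe_iff, Rat.cast_le] at h₂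
      exact h₂.not_gt hpq
    have hres : Fᶜ ∈ residual K :=
      residual_of_dense_open hFc.isOpen_compl (interior_eq_empty_iff_dense_compl.1 hint)
    filter_upwards [hres] with ω hω _ h₁ h₂
    exact hω ⟨h₁, h₂⟩
  filter_upwards [eventually_countable_forall.2 key] with ω hω
  refine ⟨?_, fun b hb => ?_⟩
  · rintro _ ⟨n, rfl⟩
    exact h.1 ⟨n, rfl⟩ ω
  · by_contra hlt
    obtain ⟨q, hbq, hqu⟩ := EReal.exists_rat_btwn_of_lt (not_le.1 hlt)
    obtain ⟨p, hbp, hpq⟩ := EReal.exists_rat_btwn_of_lt hbq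
    refine hω (p, q) (by exact_mod_cast hpq) (fun n => ?_) hqu.le
    exact (hb ⟨n, rfl⟩).trans hbp.le

theorem IsPosIntegral.aeEq [BaireSpace K] [IsOrderedAddMonoid E] (he : IsWeakUnit e)
    (hΦ : IsMaedaOgasawara e Φ) {X : E} {g : ℝ → ℝ} {G : CInfty K}
    (h : IsPosIntegral Φ e X g G) : AEEq G fun ω => g (Φ X ω).toReal := by
  obtain ⟨-, u, ⟨gn, y, hy, -, hlub, hu⟩, huG⟩ := h
  filter_upwards [eventually_isLUB hu, eventually_countable_forall.2 fun n => (hy n).aeEq he hΦ]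
    with ω h₁ h₂
  have h₃ : (fun n => (SupCompletion.of Φ (y n)).1 ω) =
      fun n => (gn n (Φ X ω).toReal : EReal) := funext h₂
  rw [h₃] at h₁
  change G.1 ω = _
  rw [← huG]
  exact h₁.unique (hlub _)

theorem IsDaniellIntegral.eq_comp [BaireSpace K] [IsOrderedAddMonoid E] (he : IsWeakUnit e)
    (hΦ : IsMaedaOgasawara e Φ) {X : E} {f : ℝ → ℝ} (hf : Continuous f) {z : CInfty K}
    (h : IsDaniellIntegral Φ e X f z) : z = CInfty.comp f hf (Φ X) := by
  obtain ⟨g, h, G, H, hG, hH, rfl, rfl⟩ := h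
  exact ((hG.aeEq he hΦ).sub (hH.aeEq he hΦ)).eq (aeEq_comp _ hf _)

end Representation

/-! ### Approximation of continuous functions by step functions -/

section Approximation

variable {E : Type*} [AddCommGroup E] [ConditionallyCompleteLattice E] [Module ℝ E]

theorem exists_isSpectralMeasure_halfOpen (e X : E) (a b : EReal) :
    ∃ m, IsSpectralMeasure e X (halfOpen a b) m := by
  by_cases hab : a < b
  · exact ⟨_, 1, fun _ => a, fun _ => b, fun _ => hab,
      fun i j hij => absurd (Subsingleton.elim i j) hij, by simp [Set.iUnion_const], rfl⟩
  · refine ⟨_, 0, Fin.elim0, Fin.elim0, fun i => i.elim0, fun i => i.elim0, ?_, rfl⟩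
    rw [Set.iUnion_of_empty]
    exact Set.eq_empty_of_forall_notMem fun t ht => hab (ht.1.trans_le ht.2)

/-- A function `t ↦ c (k t)`, where `k` takes values in a finite type and has half open intervals
as fibres, is a step function. -/
theorem exists_isStepIntegral_of_fibers (e X : E) {ι : Type*} [Fintype ι] (k : ℝ → ι)
    (hk : ∀ i, ∃ a b, k ⁻¹' {i} = halfOpen a b) (c : ι → ℝ) :
    ∃ y, IsStepIntegral e X (fun t => c (k t)) y := by
  classical
  have hm : ∀ i, ∃ m, IsSpectralMeasure e X (k ⁻¹' {i}) m := fun i => by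
    obtain ⟨a, b, h⟩ := hk i
    rw [h]
    exact exists_isSpectralMeasure_halfOpen e X a b
  choose m hm using hm
  let φ := (Fintype.equivFin ι).symm
  refine ⟨_, Fintype.card ι, c ∘ φ, fun i => k ⁻¹' {φ i}, m ∘ φ, fun i => hm _, ?_, ?_, ?_, rfl⟩
  · intro i j hij
    exact Disjoint.preimage _ (Set.disjoint_singleton.2 (φ.injective.ne hij))
  · exact Set.eq_univ_of_forall fun t => Set.mem_iUnion.2 ⟨φ.symm (k t), by simp⟩
  · intro t
    change c (k t) = ∑ i, (k ⁻¹' {φ i}).indicator (fun _ => c (φ i)) t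
    rw [φ.sum_comp fun i => (k ⁻¹' {i}).indicator (fun _ => c i) t]
    simp [Set.indicator, eq_comm]

/-- The position of `t` relative to the points `r 0, …, r (n - 1)`. -/
noncomputable def cutPattern (r : ℕ → ℝ) (n : ℕ) (t : ℝ) : Fin n → Prop := fun i => t ≤ r i

theorem exists_cutPattern_preimage (r : ℕ → ℝ) (n : ℕ) (p : Fin n → Prop) :
    ∃ a b, cutPattern r n ⁻¹' {p} = halfOpen a b := by
  classical
  refine ⟨(Finset.univ.filter fun i => ¬ p i).sup fun i => (r i : EReal),
    (Finset.univ.filter fun i => p i).inf fun i => (r i : EReal), ?_⟩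
  ext t
  simp only [mem_preimage, mem_singleton_iff, halfOpen, mem_ofPred_eq,
    Finset.sup_lt_iff (EReal.bot_lt_coe t), Finset.le_inf_iff, Finset.mem_filter,
    Finset.mem_univ, true_and, EReal.coe_lt_coe_iff, EReal.coe_le_coe_iff, funext_iff,
    cutPattern, eq_iff_iff]
  constructor
  · intro h
    exact ⟨fun i hi => not_le.1 fun hn => hi ((h i).1 hn), fun i hi => (h i).2 hi⟩
  · rintro ⟨h₁, h₂⟩ i
    exact ⟨fun h => by_contra fun hn => (h₁ i hn).not_ge h, h₂ i⟩

/-- The infimum of `f` over the cell of `t` in the partition of `ℝ` cut out by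
`r 0, …, r (n - 1)`. -/
noncomputable def cellInf (f : ℝ → ℝ) (r : ℕ → ℝ) (n : ℕ) (t : ℝ) : ℝ :=
  sInf (f '' (cutPattern r n ⁻¹' {cutPattern r n t}))

theorem exists_isStepIntegral_cellInf (e X : E) (f : ℝ → ℝ) (r : ℕ → ℝ) (n : ℕ) :
    ∃ y, IsStepIntegral e X (cellInf f r n) y := by
  classical
  exact exists_isStepIntegral_of_fibers e X (cutPattern r n) (exists_cutPattern_preimage r n)
    fun p => sInf (f '' (cutPattern r n ⁻¹' {p}))

theorem bddBelow_image_of_nonneg {f : ℝ → ℝ} (hf : ∀ t, 0 ≤ f t) (s : Set ℝ) :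
    BddBelow (f '' s) := ⟨0, by rintro _ ⟨t, -, rfl⟩; exact hf t⟩

theorem cellInf_le {f : ℝ → ℝ} (hf : ∀ t, 0 ≤ f t) (r : ℕ → ℝ) (n : ℕ) (t : ℝ) :
    cellInf f r n t ≤ f t :=
  csInf_le (bddBelow_image_of_nonneg hf _) ⟨t, rfl, rfl⟩

theorem monotone_cellInf {f : ℝ → ℝ} (hf : ∀ t, 0 ≤ f t) (r : ℕ → ℝ) (t : ℝ) :
    Monotone fun n => cellInf f r n t := by
  intro n m hnm
  refine csInf_le_csInf (bddBelow_image_of_nonneg hf _) ⟨f t, t, rfl, rfl⟩ (Set.image_mono ?_)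
  intro s hs
  exact funext fun i => congrFun hs (Fin.castLE hnm i)

theorem isLUB_cellInf {f : ℝ → ℝ} (hfc : Continuous f) (hf : ∀ t, 0 ≤ f t) {r : ℕ → ℝ}
    (hr : DenseRange r) (t : ℝ) :
    IsLUB (range fun n => (cellInf f r n t : EReal)) (f t : EReal) := by
  refine ⟨?_, fun b hb => ?_⟩
  · rintro _ ⟨n, rfl⟩
    exact EReal.coe_le_coe_iff.2 (cellInf_le hf r n t)
  · by_contra hlt
    obtain ⟨c, hbc, hcf⟩ := EReal.lt_iff_exists_real_btwn.1 (not_le.1 hlt)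
    have hnhds : {s | c < f s} ∈ 𝓝 t :=
      (isOpen_lt continuous_const hfc).mem_nhds (EReal.coe_lt_coe_iff.1 hcf)
    obtain ⟨l, u, ⟨hlt, htu⟩, hsub⟩ := mem_nhds_iff_exists_Ioo_subset.1 hnhds
    -- Two points of the sequence close to `t`, on either side, confine the cell of `t`.
    obtain ⟨i, hi⟩ := hr.exists_mem_open isOpen_Ioo (nonempty_Ioo.2 hlt)
    obtain ⟨j, hj⟩ := hr.exists_mem_open isOpen_Ioo (nonempty_Ioo.2 htu)
    have hc : c ≤ cellInf f r (max i j + 1) t := by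
      refine le_csInf ⟨f t, t, rfl, rfl⟩ ?_
      rintro _ ⟨s, hs, rfl⟩
      have h₁ : s ≤ r i ↔ t ≤ r i := iff_of_eq (congrFun hs ⟨i, by omega⟩)
      have h₂ : s ≤ r j ↔ t ≤ r j := iff_of_eq (congrFun hs ⟨j, by omega⟩)
      have h₃ : r i < s := not_le.1 fun h => (h₁.1 h).not_gt hi.2
      have h₄ : s ≤ r j := h₂.2 hj.1.le
      exact (hsub ⟨hi.1.trans h₃, h₄.trans_lt hj.2⟩ : c < f s).le
    exact hbc.not_ge ((EReal.coe_le_coe_iff.2 hc).trans (hb ⟨_, rfl⟩))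

end Approximation

/-! ### Existence of the integral of a continuous function -/

section Existence

variable {E : Type*} [AddCommGroup E] [ConditionallyCompleteLattice E] [Module ℝ E]
  {K : Type*} [TopologicalSpace K] [ExtremallyDisconnected K] {e : E} {Φ : E →ₗ[ℝ] CInfty K}

theorem isPosIntegral_comp [BaireSpace K] [IsOrderedAddMonoid E] (he : IsWeakUnit e)
    (hΦ : IsMaedaOgasawara e Φ) (X : E) {f : ℝ → ℝ} (hfc : Continuous f) (hf : ∀ t, 0 ≤ f t) :
    IsPosIntegral Φ e X f (CInfty.comp f hfc (Φ X)) := by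
  have hr : DenseRange (TopologicalSpace.denseSeq ℝ) :=
    TopologicalSpace.denseRange_denseSeq ℝ
  generalize TopologicalSpace.denseSeq ℝ = r at hr
  choose y hy using exists_isStepIntegral_cellInf e X f r
  have hy' := fun n => (hy n).aeEq he hΦ
  have hc := aeEq_comp f hfc (Φ X)
  have hub : ∀ n, (Φ (y n)).1 ≤ (CInfty.comp f hfc (Φ X)).1 := fun n =>
    (hy' n).le hc (.of_forall fun ω => cellInf_le hf r n _)
  refine ⟨hf, ⟨(CInfty.comp f hfc (Φ X)).1, y 0, hub 0⟩, ⟨cellInf f r, y, hy,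
    monotone_cellInf hf r, isLUB_cellInf hfc hf hr, ?_, ?_⟩, rfl⟩
  · rintro _ ⟨n, rfl⟩
    exact hub n
  · intro w hw
    refine le_of_eventually_le (u := (CInfty.comp f hfc (Φ X)).1) (v := w.1) ?_
    filter_upwards [eventually_countable_forall.2 hy', hc] with ω h₁ h₂
    rw [h₂]
    refine (isLUB_cellInf hfc hf hr _).2 ?_
    rintro _ ⟨n, rfl⟩
    change (cellInf f r n (Φ X ω).toReal : EReal) ≤ _
    rw [← h₁ n]
    exact hw ⟨n, rfl⟩ ω

end Existence

theorem mainTheorem1 {E : Type*} [AddCommGroup E] [ConditionallyCompleteLattice E]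
    [IsOrderedAddMonoid E] [Module ℝ E] [PosSMulMono ℝ E]
    {K : Type*} [TopologicalSpace K] [CompactSpace K] [T2Space K] [ExtremallyDisconnected K]
    (e : E) (he : IsWeakUnit e)
    (Φ : E →ₗ[ℝ] CInfty K) (hΦ : IsMaedaOgasawara e Φ)
    (X : E) (f : ℝ → ℝ) (hf : Continuous f) :
    f ∈ classLu Φ e X ∧
      ∀ z : CInfty K, IsDaniellIntegral Φ e X f z ↔ z = CInfty.comp f hf (Φ X) := by
  have hg := isPosIntegral_comp he hΦ X (hf.max continuous_const) fun t => le_max_right (f t) 0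
  have hh := isPosIntegral_comp he hΦ X (hf.neg.max continuous_const)
    fun t => le_max_right (-f t) 0
  have hfgh : f = (fun t => max (f t) 0) - fun t => max (-f t) 0 := by
    funext t
    exact (posPart_sub_negPart (f t)).symm
  refine ⟨⟨_, _, ⟨_, hg⟩, ⟨_, hh⟩, hfgh⟩, fun z => ⟨fun hz => hz.eq_comp he hΦ hf, ?_⟩⟩
  rintro rfl
  have hD : IsDaniellIntegral Φ e X f _ := ⟨_, _, _, _, hg, hh, hfgh, rfl⟩
  rwa [hD.eq_comp he hΦ hf] at hD
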